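/- **Setting.** For exponents $\alpha^{(1)},\dots,\alpha^{(\ell)}\in\mathbb{R}^n$ a signomial with respect to these exponents is a function $f(x)=\sum_{j=1}^{\ell} c_j\exp\{\alpha^{(j)\prime}x\}$ on $\mathbb{R}^n$ with $c_j\in\mathbb{R}$. For $p\in\mathbb{Z}_{\ge 0}$ let $E_p=\{\sum_{j=1}^{\ell}\lambda_j\alpha^{(j)} : \lambda_j\in\mathbb{Z}_{\ge 0},\ \sum_j\lambda_j\le p\}$. An AM/GM-exponential with exponents in a finite set $M\subset\mathbb{R}^n$ is a function $g(x)=\sum_{a\in M} b_a\exp\{a'x\}$ with at most one negative coefficient $b_a$ and $g(x)\ge 0$ for all $x\in\mathbb{R}^n$; $\mathrm{SAGE}(M)$ is the set of all finite sums of AM/GM-exponentials with exponents in $M$. For a signomial $f$ put $f_\star=\inf_{x\in\mathbb{R}^n}f(x)$ and $$f^{(p)}_{\mathrm{SAGE}}=\sup\Big\{\gamma\in\mathbb{R} : \Big(\sum_{j=1}^{\ell}\exp\{\alpha^{(j)\prime}x\}\Big)^p\,[f(x)-\gamma]\in\mathrm{SAGE}(E_{p+1})\Big\},$$ both as extended real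 numbers. **Theorem.** Let $\ell\ge n+1$ and let $\alpha^{(1)},\dots,\alpha^{(\ell)}\in\mathbb{Q}^n$ be such that (a) $\alpha^{(1)},\dots,\alpha^{(n)}$ are linearly independent; (b) $\alpha^{(n+1)}=0$; (c) for every $j=n+2,\dots,\ell$, $\alpha^{(j)}\in\mathrm{conv}\{\alpha^{(1)},\dots,\alpha^{(n+1)}\}$ and $\alpha^{(j)}\notin\mathrm{conv}\{\alpha^{(1)},\dots,\alpha^{(n)}\}$. Let $f(x)=\sum_{j=1}^{\ell}c_j\exp\{\alpha^{(j)\prime}x\}$ be a signomial with respect to these exponents with $c_1,\dots,c_n>0$. 1. If $\inf_{x\in\mathbb{R}^n}f(x)>0$, then there exists $p\in\mathbb{Z}_{\ge 0}$ such that $\big(\sum_{j=1}^{\ell}\exp\{\alpha^{(j)\prime}x\}\big)^p f(x)\in\mathrm{SAGE}(E_{p+1})$. 2. (Completeness; no positivity of the infimum is assumed.) One has $f^{(p)}_{\mathrm{SAGE}}\le f_\star$ for every $p\in\mathbb{Z}_{\ge 0}$, and $f^{(p)}_{\mathrm{SAGE}}\to f_\star$ as $p\to\infty$. -/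

import Mathlib

open Filter Topology

noncomputable section

/-- The signomial `x ↦ ∑ j, c j * exp ⟨α j, x⟩` on `ℝⁿ`. -/
def signomial {n : ℕ} {ι : Type*} [Fintype ι] (α : ι → Fin n → ℝ) (c : ι → ℝ)
    (x : Fin n → ℝ) : ℝ :=
  ∑ j, c j * Real.exp (α j ⬝ᵥ x)

/-- `E_p(α)`: the sums of at most `p` exponents of the collection, with repetition. -/
def exponentSums {n : ℕ} {ι : Type*} [Fintype ι] (p : ℕ) (α : ι → Fin n → ℝ) :
    Set (Fin n → ℝ) :=
  {v | ∃ k : ι → ℕ, ∑ j, k j ≤ p ∧ v = ∑ j, k j • α j}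

/-- `g` is an AM/GM-exponential with exponents in `M`: a globally nonnegative signomial with at
most one negative coefficient. The coefficient `c a` belongs to the exponent `a`, so like terms
are collected. -/
def IsAMGMExponential {n : ℕ} (M : Set (Fin n → ℝ)) (g : (Fin n → ℝ) → ℝ) : Prop :=
  ∃ c : (Fin n → ℝ) →₀ ℝ, (c.support : Set (Fin n → ℝ)) ⊆ M ∧
    {a | c a < 0}.Subsingleton ∧
    (∀ x, g x = ∑ a ∈ c.support, c a * Real.exp (a ⬝ᵥ x)) ∧
    ∀ x, 0 ≤ g x

/-- `SAGE(M)`: the finite sums of AM/GM-exponentials with exponents in `M`. -/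
def SAGE {n : ℕ} (M : Set (Fin n → ℝ)) : Set ((Fin n → ℝ) → ℝ) :=
  {f | ∃ (m : ℕ) (F : Fin m → (Fin n → ℝ) → ℝ),
    (∀ i, IsAMGMExponential M (F i)) ∧ ∀ x, f x = ∑ i, F i x}

/-- The global infimum of a function on `ℝⁿ`, as an extended real. -/
def globalInf {n : ℕ} (f : (Fin n → ℝ) → ℝ) : EReal :=
  ⨅ x, (f x : EReal)

/-- The function `(∑ j, exp ⟨α j, x⟩) ^ p * f x`. -/
def multiplied {n : ℕ} {ι : Type*} [Fintype ι] (α : ι → Fin n → ℝ) (p : ℕ)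
    (f : (Fin n → ℝ) → ℝ) (x : Fin n → ℝ) : ℝ :=
  (∑ j, Real.exp (α j ⬝ᵥ x)) ^ p * f x

/-- The level-`p` lower bound: the supremum (in the extended reals, so `⊥` if there is no
feasible `γ`) of all real `γ` such that `(∑ j, exp ⟨α j, x⟩) ^ p * (f x - γ)` is a SAGE function
with respect to `E_{p+1}(α)`. -/
def sageBound {n : ℕ} {ι : Type*} [Fintype ι] (α : ι → Fin n → ℝ) (p : ℕ)
    (f : (Fin n → ℝ) → ℝ) : EReal :=
  sSup ((fun γ : ℝ => (γ : EReal)) ''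
    {γ : ℝ | multiplied α p (fun x => f x - γ) ∈ SAGE (exponentSums (p + 1) α)})

end

/-! Put `y j = exp (α j ⬝ᵥ x)`, so that `f` becomes a linear form in `y`. Rational barycentric
coordinates with common denominator `q` give homogeneous binomial relations `y j ^ q = ∏ y i ^ m j
i`. On the part of the standard simplex where they hold, the linear form is positive
(`sum_pos_of_relations`): where `y n > 0` by the lower bound on `f`, and where `y n = 0` because
only `c 0, …, c (n-1)` survive. By compactness, a large multiple of the sum of squares of the
relations extends positivity to the whole simplex, and `polya` then makes all coefficients
nonnegative after multiplication by a power of `∑ y j`. Substituting exponentials kills the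
relations and leaves a sum of exponentials with nonnegative coefficients, which is trivially SAGE.
Completeness follows by applying this to `f - γ` for `γ` below the infimum. -/

/-! ### Pólya's theorem -/

/-- The polynomial `∑ a_β ∏ᵢ yᵢ (yᵢ - t) ⋯ (yᵢ - (βᵢ - 1) t)` obtained from `F = ∑ a_β y^β`. -/
def fallingEval {ι : Type*} [Fintype ι] (F : MvPolynomial ι ℝ) (t : ℝ) (y : ι → ℝ) : ℝ :=
  ∑ β ∈ F.support, F.coeff β * ∏ i, ∏ k ∈ Finset.range (β i), (y i - k * t)

theorem fallingEval_zero {ι : Type*} [Fintype ι] (F : MvPolynomial ι ℝ) (y : ι → ℝ) :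
    fallingEval F 0 y = MvPolynomial.eval y F := by
  simp [fallingEval, MvPolynomial.eval_eq']

theorem continuous_fallingEval {ι : Type*} [Fintype ι] (F : MvPolynomial ι ℝ) :
    Continuous (fun z : ℝ × (ι → ℝ) => fallingEval F z.1 z.2) := by
  unfold fallingEval
  fun_prop

theorem factorial_mul_coeff_sum_X_pow {ι : Type*} [Fintype ι] (N : ℕ) (δ : ι →₀ ℕ)
    (h : δ.degree = N) :
    (∏ i, ((δ i).factorial : ℝ)) * ((∑ i, MvPolynomial.X i : MvPolynomial ι ℝ) ^ N).coeff δ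
      = N.factorial := by
  have hs : δ.sum (fun _ m => m) = N := h
  rw [MvPolynomial.coeff_sum_X_pow_of_fintype, if_pos hs,
    Finsupp.multinomial_eq_of_support_subset (Finset.subset_univ _)]
  have := Nat.multinomial_spec Finset.univ δ
  rw [Finsupp.degree_eq_sum] at h
  rw [h] at this
  exact_mod_cast this

theorem factorial_mul_coeff_sum_X_pow_mul_monomial {ι : Type*} [Fintype ι] (N d : ℕ)
    (γ β : ι →₀ ℕ) (a : ℝ) (hβ : β.degree = d) (hγ : γ.degree = N + d) :
    (∏ i, ((γ i).factorial : ℝ)) *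
        ((∑ i, MvPolynomial.X i : MvPolynomial ι ℝ) ^ N * MvPolynomial.monomial β a).coeff γ
      = N.factorial * (a * ∏ i, ((γ i).descFactorial (β i) : ℝ)) := by
  rw [MvPolynomial.coeff_mul_monomial']
  split_ifs with hle
  · have hdeg : (γ - β).degree = N := by
      have : (γ - β).degree + β.degree = γ.degree := by
        rw [← map_add, tsub_add_cancel_of_le hle]
      omega
    rw [← factorial_mul_coeff_sum_X_pow N _ hdeg]
    have hprod : (∏ i, ((γ i).factorial : ℝ)) =
        (∏ i, (((γ - β) i).factorial : ℝ)) * ∏ i, ((γ i).descFactorial (β i) : ℝ) := by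
      rw [← Finset.prod_mul_distrib]
      refine Finset.prod_congr rfl fun i _ => ?_
      rw [← Nat.factorial_mul_descFactorial (hle i)]
      simp
    rw [hprod]
    ring
  -- If `β ≰ γ`, the coefficient and the falling factorial both vanish.
  · obtain ⟨i, hi⟩ : ∃ i, ¬ β i ≤ γ i := by simpa [Finsupp.le_def] using hle
    have : ∏ i, ((γ i).descFactorial (β i) : ℝ) = 0 :=
      Finset.prod_eq_zero (Finset.mem_univ i) (by
        rw [Nat.descFactorial_eq_zero_iff_lt.2 (not_le.1 hi)]; simp)
    rw [this]
    simp

/-- Multinomial coefficients turn each `y^β` into falling factorials of `γ`; rescaling by the total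
degree gives a perturbation of `F` at a point of the simplex, with parameter tending to `0`. -/
theorem factorial_mul_coeff_sum_X_pow_mul {ι : Type*} [Fintype ι] (F : MvPolynomial ι ℝ)
    (N d : ℕ) (hF : F.IsHomogeneous d) (γ : ι →₀ ℕ) (hγ : γ.degree = N + d) (hpos : 0 < N + d) :
    (∏ i, ((γ i).factorial : ℝ)) *
        ((∑ i, MvPolynomial.X i : MvPolynomial ι ℝ) ^ N * F).coeff γ
      = N.factorial * (N + d : ℝ) ^ d *
        fallingEval F (1 / (N + d : ℝ)) (fun i => γ i / (N + d : ℝ)) := by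
  have hM : (0 : ℝ) < N + d := by exact_mod_cast hpos
  conv_lhs => rw [F.as_sum, Finset.mul_sum, MvPolynomial.coeff_sum, Finset.mul_sum]
  rw [fallingEval, Finset.mul_sum]
  refine Finset.sum_congr rfl fun β hβ => ?_
  have hdeg : β.degree = d := by
    rw [Finsupp.degree_eq_weight_one]; exact hF (MvPolynomial.mem_support_iff.1 hβ)
  rw [factorial_mul_coeff_sum_X_pow_mul_monomial N d γ β _ hdeg hγ]
  have hpow : (N + d : ℝ) ^ d = ∏ i, (N + d : ℝ) ^ β i := by
    rw [Finset.prod_pow_eq_pow_sum, ← Finsupp.degree_eq_sum, hdeg]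
  have : ∏ i, ((γ i).descFactorial (β i) : ℝ) = (N + d : ℝ) ^ d *
      ∏ i, ∏ k ∈ Finset.range (β i), ((γ i : ℝ) / (N + d : ℝ) - k * (1 / (N + d : ℝ))) := by
    rw [hpow, ← Finset.prod_mul_distrib]
    refine Finset.prod_congr rfl fun i _ => ?_
    rw [← descPochhammer_eval_eq_descFactorial, descPochhammer_eval_eq_prod_range]
    conv_rhs => rw [← Finset.card_range (β i), ← Finset.prod_const, Finset.card_range,
      ← Finset.prod_mul_distrib]
    refine Finset.prod_congr rfl fun k _ => ?_
    field_simp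
  rw [this]
  ring

/-- **Pólya's theorem**: if a homogeneous polynomial is positive on the standard simplex, then its
product with any sufficiently high power of the sum of the variables has nonnegative
coefficients. -/
theorem polya {ι : Type*} [Fintype ι] (F : MvPolynomial ι ℝ) (d : ℕ) (hF : F.IsHomogeneous d)
    (hpos : ∀ y ∈ stdSimplex ℝ ι, 0 < MvPolynomial.eval y F) :
    ∀ᶠ N : ℕ in atTop, ∀ γ,
      0 ≤ ((∑ i, MvPolynomial.X i : MvPolynomial ι ℝ) ^ N * F).coeff γ := by
  -- Compactness of the simplex makes the smallness of `t` uniform in `y`.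
  have hev : ∀ᶠ t : ℝ in 𝓝 0, ∀ y ∈ stdSimplex ℝ ι, 0 < fallingEval F t y := by
    refine (isCompact_stdSimplex ℝ ι).eventually_forall_of_forall_eventually fun y hy => ?_
    refine (continuous_fallingEval F).continuousAt.eventually (lt_mem_nhds ?_)
    simpa [fallingEval_zero] using hpos y hy
  have hlim : Tendsto (fun N : ℕ => 1 / ((N : ℝ) + d)) atTop (𝓝 0) := by
    simp_rw [one_div]
    exact tendsto_inv_atTop_zero.comp
      (tendsto_atTop_add_const_right _ _ tendsto_natCast_atTop_atTop)
  filter_upwards [hlim.eventually hev, eventually_gt_atTop 0] with N hN hN0 γ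
  by_cases hγ : γ.degree = N + d
  · have hM : (0 : ℝ) < N + d := by positivity
    have hmem : (fun i => (γ i : ℝ) / (N + d : ℝ)) ∈ stdSimplex ℝ ι := by
      refine ⟨fun i => by positivity, ?_⟩
      rw [← Finset.sum_div, div_eq_one_iff_eq hM.ne']
      rw [Finsupp.degree_eq_sum] at hγ
      exact_mod_cast hγ
    have key := factorial_mul_coeff_sum_X_pow_mul F N d hF γ hγ (by omega)
    have hf : (0 : ℝ) < ∏ i, ((γ i).factorial : ℝ) :=
      Finset.prod_pos fun i _ => by exact_mod_cast Nat.factorial_pos _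
    refine nonneg_of_mul_nonneg_right ?_ hf
    rw [key]
    have := hN _ hmem
    positivity
  · have hhom : ((∑ i, MvPolynomial.X i : MvPolynomial ι ℝ) ^ N * F).IsHomogeneous (N + d) := by
      have h1 : (∑ i, MvPolynomial.X i : MvPolynomial ι ℝ).IsHomogeneous 1 :=
        MvPolynomial.IsHomogeneous.sum _ _ _ fun i _ => MvPolynomial.isHomogeneous_X _ i
      simpa using (h1.pow N).mul hF
    rw [hhom.coeff_eq_zero hγ]

/-! ### Compactness: penalizing the relations -/

/-- A continuous function that is positive on the zeros of a nonnegative continuous `H` in a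
compact set becomes positive on the whole set after adding a multiple of `H`. -/
theorem exists_pos_add_mul_of_pos_on_zeros {X : Type*} [TopologicalSpace X] {K : Set X}
    (hK : IsCompact K) {G H : X → ℝ} (hG : Continuous G) (hH : Continuous H)
    (hH0 : ∀ x ∈ K, 0 ≤ H x) (hpos : ∀ x ∈ K, H x = 0 → 0 < G x) :
    ∃ C : ℝ, ∀ x ∈ K, 0 < G x + C * H x := by
  have hS : IsCompact (K ∩ {x | G x ≤ 0}) := hK.inter_right (isClosed_le hG continuous_const)
  have hHpos : ∀ x ∈ K ∩ {x | G x ≤ 0}, 0 < H x := fun x hx =>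
    (hH0 x hx.1).lt_of_ne fun h => absurd (hpos x hx.1 h.symm) (not_lt.2 hx.2)
  have hcont : ContinuousOn (fun x => -G x / H x) (K ∩ {x | G x ≤ 0}) :=
    hG.neg.continuousOn.div hH.continuousOn fun x hx => (hHpos x hx).ne'
  obtain ⟨B, hB⟩ := hS.bddAbove_image hcont
  -- Exceeding `B` handles the points with `G ≤ 0`; being nonnegative does no harm elsewhere.
  refine ⟨max B 0 + 1, fun x hx => ?_⟩
  by_cases hGx : G x ≤ 0
  · have h1 : -G x / H x ≤ B := hB ⟨x, ⟨hx, hGx⟩, rfl⟩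
    have h2 := hHpos x ⟨hx, hGx⟩
    rw [div_le_iff₀ h2] at h1
    nlinarith [mul_le_mul_of_nonneg_right (le_max_left B 0) h2.le]
  · have h3 : 0 ≤ (max B 0 + 1) * H x :=
      mul_nonneg (by linarith [le_max_right B 0]) (hH0 x hx)
    linarith [not_le.1 hGx]

/-! ### Rational barycentric coordinates -/

theorem sum_eq_of_support_le {M : Type*} [AddCommMonoid M] {n l : ℕ} (hl : n < l)
    (g : Fin l → M) (hg : ∀ i : Fin l, n < i.val → g i = 0) :
    ∑ i, g i = ∑ i : Fin n, g ⟨i.val, by omega⟩ + g ⟨n, by omega⟩ := by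
  obtain ⟨k, rfl⟩ := Nat.exists_eq_add_of_le (Nat.succ_le_of_lt hl)
  rw [Fin.sum_univ_add, Fin.sum_univ_castSucc,
    Finset.sum_eq_zero (s := Finset.univ) (f := fun i : Fin k => g (Fin.natAdd (n + 1) i)), add_zero]
  · rfl
  · intro i _
    exact hg _ (by simp; omega)

theorem exists_weights_of_mem_convexHull_image {ι E : Type*} [Fintype ι] [AddCommGroup E]
    [Module ℝ E] (α : ι → E) (S : Set ι) {v : E} (hv : v ∈ convexHull ℝ (α '' S)) :
    ∃ w : ι → ℝ, (∀ i, 0 ≤ w i) ∧ ∑ i, w i = 1 ∧ (∀ i, i ∉ S → w i = 0) ∧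
      v = ∑ i, w i • α i := by
  classical
  refine convexHull_min (t := {v | ∃ w : ι → ℝ, (∀ i, 0 ≤ w i) ∧ ∑ i, w i = 1 ∧
    (∀ i, i ∉ S → w i = 0) ∧ v = ∑ i, w i • α i}) ?_ ?_ hv
  · rintro _ ⟨i, hi, rfl⟩
    refine ⟨Pi.single i 1, fun j => ?_, by simp, fun j hj => ?_, ?_⟩
    · by_cases h : j = i
      · subst h; simp
      · simp [h]
    · exact Pi.single_eq_of_ne (by rintro rfl; exact hj hi) _
    · simp [Pi.single_apply]
  · rintro _ ⟨w, h0, h1, hS, rfl⟩ _ ⟨w', h0', h1', hS', rfl⟩ a b ha hb hab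
    refine ⟨fun i => a * w i + b * w' i, fun i => ?_, ?_, fun i hi => ?_, ?_⟩
    · have := h0 i; have := h0' i; positivity
    · rw [Finset.sum_add_distrib, ← Finset.mul_sum, ← Finset.mul_sum, h1, h1']; simpa using hab
    · simp [hS i hi, hS' i hi]
    · simp [Finset.smul_sum, add_smul, Finset.sum_add_distrib, mul_smul]

/-- A rational vector has rational coordinates in a basis of rational vectors. -/
theorem exists_rat_coordinates {n : ℕ} (v : Fin n → Fin n → ℚ)
    (hv : LinearIndependent ℝ (fun i k => (v i k : ℝ))) (b : Fin n → ℚ) (u : Fin n → ℝ)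
    (h : ∑ i, u i • (fun k => (v i k : ℝ)) = fun k => (b k : ℝ)) :
    ∀ i, ∃ r : ℚ, u i = r := by
  have hQ : LinearIndependent ℚ v := by
    have h1 : LinearIndependent ℚ (fun i k => (v i k : ℝ)) :=
      hv.restrict_scalars' ℚ
    refine LinearIndependent.of_comp
      (LinearMap.compLeft (Algebra.linearMap ℚ ℝ) (Fin n)) ?_
    exact h1
  have hspan : b ∈ Submodule.span ℚ (Set.range v) := by
    rw [hQ.span_eq_top_of_card_eq_finrank' (by simp)]; trivial
  obtain ⟨r, hr⟩ := (Submodule.mem_span_range_iff_exists_fun ℚ).1 hspan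
  have heq : ∑ i, u i • (fun k => (v i k : ℝ)) =
      ∑ i, (r i : ℝ) • (fun k => (v i k : ℝ)) := by
    rw [h]
    ext k
    rw [← hr]
    simp
  have hzero : ∑ i, (u i - r i) • (fun k => (v i k : ℝ)) = 0 := by
    simp_rw [sub_smul]
    rw [Finset.sum_sub_distrib, heq, sub_self]
  intro i
  exact ⟨r i, sub_eq_zero.1 (Fintype.linearIndependent_iff.1 hv _ hzero i)⟩

theorem exists_nat_multiples {κ : Type*} [Fintype κ] (w : κ → ℝ) (h0 : ∀ i, 0 ≤ w i)
    (hr : ∀ i, ∃ r : ℚ, w i = r) :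
    ∃ q : ℕ, 0 < q ∧ ∃ m : κ → ℕ, ∀ i, (m i : ℝ) = q * w i := by
  choose r hr using hr
  have hr0 : ∀ i, 0 ≤ r i := fun i => by have := h0 i; rw [hr] at this; exact_mod_cast this
  refine ⟨∏ i, (r i).den, Finset.prod_pos fun i _ => (r i).den_pos, ?_⟩
  have : ∀ i, ∃ m : ℕ, (m : ℝ) = (∏ i, (r i).den : ℕ) * w i := by
    intro i
    obtain ⟨k, hk⟩ := Finset.dvd_prod_of_mem (fun i => (r i).den) (Finset.mem_univ i)
    refine ⟨k * (r i).num.toNat, ?_⟩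
    rw [hk, hr]
    have h1 : (((r i).num.toNat : ℤ) : ℚ) = (r i).den * r i := by
      rw [Int.toNat_of_nonneg (Rat.num_nonneg.2 (hr0 i)), Rat.den_mul_eq_num]
    have h2 : ((r i).num.toNat : ℝ) = (r i).den * r i := by exact_mod_cast h1
    push_cast
    rw [h2]
    ring
  exact ⟨fun i => (this i).choose, fun i => (this i).choose_spec⟩

/-- Under the simplex hypotheses, all exponents are rational convex combinations of the first
`n + 1`, with a common denominator. -/
theorem exists_barycentric_relations {n l : ℕ} (hl : n < l) (α : Fin l → Fin n → ℝ)
    (hrat : ∀ j k, ∃ q : ℚ, α j k = (q : ℝ))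
    (hind : LinearIndependent ℝ (fun i : Fin n => α ⟨i.val, by omega⟩))
    (hzero : α ⟨n, by omega⟩ = 0)
    (hconv : ∀ j : Fin l, n < j.val →
      α j ∈ convexHull ℝ (α '' {i : Fin l | i.val ≤ n}) ∧
      α j ∉ convexHull ℝ (α '' {i : Fin l | i.val < n})) :
    ∃ q : ℕ, 0 < q ∧ ∃ m : Fin l → Fin l → ℕ, ∀ j,
      ∑ i, m j i = q ∧ (∀ i : Fin l, n < i.val → m j i = 0) ∧
      (q : ℝ) • α j = ∑ i, (m j i : ℝ) • α i ∧ (n < j.val → 0 < m j ⟨n, by omega⟩) := by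
  classical
  have hw : ∀ j, ∃ w : Fin l → ℝ, (∀ i, 0 ≤ w i) ∧ ∑ i, w i = 1 ∧
      (∀ i : Fin l, n < i.val → w i = 0) ∧ α j = ∑ i, w i • α i := by
    intro j
    have hj : α j ∈ convexHull ℝ (α '' {i : Fin l | i.val ≤ n}) := by
      by_cases hj : j.val ≤ n
      · exact subset_convexHull _ _ ⟨j, hj, rfl⟩
      · exact (hconv j (not_le.1 hj)).1
    obtain ⟨w, h0, h1, hS, h⟩ := exists_weights_of_mem_convexHull_image α _ hj
    exact ⟨w, h0, h1, fun i hi => hS i (by simpa using hi), h⟩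
  choose w h0 h1 hS hα using hw
  -- A zero weight at the origin would put `α j` in the excluded face.
  have hne : ∀ j : Fin l, n < j.val → w j ⟨n, by omega⟩ ≠ 0 := by
    intro j hj hwn
    have hS' : ∀ i : Fin l, ¬ i.val < n → w j i = 0 := by
      intro i hi
      rcases (not_lt.1 hi).lt_or_eq with h | h
      · exact hS j i h
      · rw [← hwn]; congr 1; exact Fin.ext h.symm
    refine (hconv j hj).2 ?_
    have hsum : ∀ {M : Type} [AddCommMonoid M] (g : Fin l → M), (∀ i, w j i = 0 → g i = 0) →
        ∑ i, g i = ∑ i ∈ Finset.univ.filter (fun i : Fin l => i.val < n), g i := by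
      intro M _ g hg
      rw [Finset.sum_filter]
      refine Finset.sum_congr rfl fun i _ => ?_
      split_ifs with h
      · rfl
      · exact hg i (hS' i h)
    rw [hα j, hsum _ (fun i hi => by rw [hi, zero_smul])]
    refine (convex_convexHull ℝ _).sum_mem (fun i _ => h0 j i) ?_ fun i hi => ?_
    · rw [← hsum _ (fun i hi => hi)]; exact h1 j
    · exact subset_convexHull _ _ ⟨i, by simpa using hi, rfl⟩
  have hwrat : ∀ j i, ∃ r : ℚ, w j i = r := by
    choose a ha using hrat
    intro j
    have hlow : ∀ i : Fin n, ∃ r : ℚ, w j ⟨i.val, by omega⟩ = r := by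
      refine exists_rat_coordinates (fun i k => a ⟨i.val, by omega⟩ k) ?_ (a j)
        (fun i => w j ⟨i.val, by omega⟩) ?_
      · simpa only [← ha] using hind
      · simp only [← ha]
        have := hα j
        rw [sum_eq_of_support_le hl _ (fun i hi => by rw [hS j i hi, zero_smul]), hzero, smul_zero,
          add_zero] at this
        exact this.symm
    choose r hr using hlow
    intro i
    rcases lt_trichotomy i.val n with h | h | h
    · exact ⟨r ⟨i, h⟩, hr ⟨i, h⟩⟩
    -- The origin contributes nothing to `α j`, so its weight is recovered from the total weight
    -- `1`.
    · refine ⟨1 - ∑ k, r k, ?_⟩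
      have := h1 j
      rw [sum_eq_of_support_le hl _ (hS j)] at this
      have hi : i = ⟨n, by omega⟩ := Fin.ext h
      rw [hi]
      push_cast
      simp_rw [← hr]
      linarith
    · exact ⟨0, by simp [hS j i h]⟩
  obtain ⟨q, hq, m, hm⟩ := exists_nat_multiples (fun p : Fin l × Fin l => w p.1 p.2)
    (fun p => h0 _ _) (fun p => hwrat _ _)
  have hq' : (0 : ℝ) < q := by exact_mod_cast hq
  refine ⟨q, hq, fun j i => m (j, i), fun j => ⟨?_, fun i hi => ?_, ?_, fun hj => ?_⟩⟩
  · have : ((∑ i, m (j, i) : ℕ) : ℝ) = q := by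
      push_cast
      simp_rw [hm, ← Finset.mul_sum, h1, mul_one]
    exact_mod_cast this
  · have : (m (j, i) : ℝ) = 0 := by rw [hm]; simp [hS j i hi]
    exact_mod_cast this
  · conv_lhs => rw [hα j]
    simp_rw [hm, Finset.smul_sum, mul_smul]
  · have : (0 : ℝ) < m (j, ⟨n, by omega⟩) := by
      rw [hm]; exact mul_pos hq' ((h0 _ _).lt_of_ne (hne j hj).symm)
    exact_mod_cast this

/-! ### Positivity on the zeros of the relations -/

theorem exists_dotProduct_eq {n : ℕ} (v : Fin n → Fin n → ℝ) (hv : LinearIndependent ℝ v)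
    (b : Fin n → ℝ) : ∃ x : Fin n → ℝ, ∀ i, v i ⬝ᵥ x = b i := by
  have hu : IsUnit (Matrix.of v) := Matrix.linearIndependent_rows_iff_isUnit.1 hv
  obtain ⟨x, hx⟩ := Matrix.mulVec_surjective_iff_isUnit.2 hu b
  exact ⟨x, fun i => congrFun hx i⟩

theorem exp_dotProduct_pow_eq {n l q : ℕ} {α : Fin l → Fin n → ℝ} {m : Fin l → ℕ} {j : Fin l}
    (h : (q : ℝ) • α j = ∑ i, (m i : ℝ) • α i) (x : Fin n → ℝ) :
    Real.exp (α j ⬝ᵥ x) ^ q = ∏ i, Real.exp (α i ⬝ᵥ x) ^ m i := by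
  simp_rw [← Real.exp_nat_mul]
  rw [← Real.exp_sum]
  congr 1
  have := congrArg (· ⬝ᵥ x) h
  simpa [sum_dotProduct, smul_dotProduct] using this

/-- Nonnegative solutions of the binomial relations satisfy every homogeneous lower bound that
holds along the exponential parametrization. -/
theorem mul_le_sum_of_relations {n l : ℕ} (hl : n < l) (α : Fin l → Fin n → ℝ)
    (c : Fin l → ℝ) (hind : LinearIndependent ℝ (fun i : Fin n => α ⟨i.val, by omega⟩))
    (hzero : α ⟨n, by omega⟩ = 0) {q : ℕ} (hq : 0 < q) (m : Fin l → Fin l → ℕ)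
    (hsum : ∀ j, ∑ i, m j i = q) (hm0 : ∀ j i : Fin l, n < i.val → m j i = 0)
    (hrel : ∀ j, (q : ℝ) • α j = ∑ i, (m j i : ℝ) • α i)
    {ε : ℝ} (hε : ∀ x, ε ≤ signomial α c x) (y : Fin l → ℝ) (hy : ∀ i, 0 ≤ y i)
    (hyrel : ∀ j, y j ^ q = ∏ i, y i ^ m j i) :
    ε * y ⟨n, by omega⟩ ≤ ∑ j, c j * y j := by
  -- Zero coordinates have no logarithm: shift by `δ > 0`, re-solve the relations by `q`-th roots,
  -- and let `δ → 0`.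
  set z : ℝ → Fin l → ℝ := fun δ j => (∏ i, (y i + δ) ^ m j i) ^ ((q : ℝ)⁻¹) with hz
  have hz0 : ∀ j, z 0 j = y j := by
    intro j
    simp only [hz, add_zero]
    rw [← hyrel j, Real.pow_rpow_inv_natCast (hy j) hq.ne']
  have hcont : Continuous (fun δ => ∑ j, c j * z δ j) := by
    refine continuous_finsetSum _ fun j _ => continuous_const.mul ?_
    exact Continuous.rpow_const (by fun_prop) fun _ => Or.inr (by positivity)
  have hlim : Tendsto (fun δ => ∑ j, c j * z δ j) (𝓝[>] 0) (𝓝 (∑ j, c j * y j)) := by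
    have := hcont.tendsto 0
    simp_rw [hz0] at this
    exact this.mono_left nhdsWithin_le_nhds
  have hlim' : Tendsto (fun δ : ℝ => ε * (y ⟨n, by omega⟩ + δ)) (𝓝[>] 0)
      (𝓝 (ε * y ⟨n, by omega⟩)) := by
    have : Continuous (fun δ : ℝ => ε * (y ⟨n, by omega⟩ + δ)) := by fun_prop
    have := this.tendsto 0
    rw [add_zero] at this
    exact this.mono_left nhdsWithin_le_nhds
  refine le_of_tendsto_of_tendsto hlim' hlim ?_
  filter_upwards [self_mem_nhdsWithin] with δ hδ
  have hδ : 0 < δ := hδ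
  have hpos : ∀ i, 0 < y i + δ := fun i => by linarith [hy i]
  set t := y ⟨n, by omega⟩ + δ with ht
  have htpos : 0 < t := hpos _
  -- By independence, the shifted point is `t` times a point of the exponential parametrization.
  obtain ⟨x, hx⟩ := exists_dotProduct_eq _ hind
    (fun i => Real.log ((y ⟨i.val, by omega⟩ + δ) / t))
  have hle : ∀ i : Fin l, i.val ≤ n → y i + δ = t * Real.exp (α i ⬝ᵥ x) := by
    intro i hi
    rcases hi.lt_or_eq with h | h
    · have := hx ⟨i, h⟩
      simp only [Fin.eta] at this
      rw [this, Real.exp_log (div_pos (hpos i) htpos)]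
      field_simp
    · have hi : i = ⟨n, by omega⟩ := Fin.ext h
      rw [hi, hzero]; simp [ht]
  have hzx : ∀ j, z δ j = t * Real.exp (α j ⬝ᵥ x) := by
    intro j
    have : ∏ i, (y i + δ) ^ m j i = (t * Real.exp (α j ⬝ᵥ x)) ^ q := by
      rw [mul_pow, exp_dotProduct_pow_eq (hrel j), ← hsum j, ← Finset.prod_pow_eq_pow_sum,
        ← Finset.prod_mul_distrib]
      refine Finset.prod_congr rfl fun i _ => ?_
      rcases le_or_gt i.val n with h | h
      · rw [hle i h, mul_pow]
      · simp [hm0 j i h]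
    simp only [hz]
    rw [this, Real.pow_rpow_inv_natCast (by positivity) hq.ne']
  have hfx := mul_le_mul_of_nonneg_right (hε x) htpos.le
  refine hfx.trans_eq ?_
  rw [signomial, Finset.sum_mul]
  refine Finset.sum_congr rfl fun j _ => ?_
  rw [hzx]; ring

/-- At `y n = 0` the relations force `y j = 0` for all `j > n`, since `y n` divides their right-hand
sides. -/
theorem sum_pos_of_relations {n l : ℕ} (hl : n < l) (α : Fin l → Fin n → ℝ)
    (c : Fin l → ℝ) (hind : LinearIndependent ℝ (fun i : Fin n => α ⟨i.val, by omega⟩))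
    (hzero : α ⟨n, by omega⟩ = 0) (hc : ∀ j : Fin l, j.val < n → 0 < c j)
    {q : ℕ} (hq : 0 < q) (m : Fin l → Fin l → ℕ)
    (hsum : ∀ j, ∑ i, m j i = q) (hm0 : ∀ j i : Fin l, n < i.val → m j i = 0)
    (hrel : ∀ j, (q : ℝ) • α j = ∑ i, (m j i : ℝ) • α i)
    (hmn : ∀ j : Fin l, n < j.val → 0 < m j ⟨n, by omega⟩)
    {ε : ℝ} (hε0 : 0 < ε) (hε : ∀ x, ε ≤ signomial α c x) (y : Fin l → ℝ)
    (hy : y ∈ stdSimplex ℝ (Fin l)) (hyrel : ∀ j, y j ^ q = ∏ i, y i ^ m j i) :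
    0 < ∑ j, c j * y j := by
  rcases (hy.1 ⟨n, by omega⟩).lt_or_eq with h | h
  · exact (mul_pos hε0 h).trans_le
      (mul_le_sum_of_relations hl α c hind hzero hq m hsum hm0 hrel hε y hy.1 hyrel)
  · have hlarge : ∀ j : Fin l, n < j.val → y j = 0 := fun j hj => by
      refine eq_zero_of_pow_eq_zero (n := q) ?_
      rw [hyrel j]
      exact Finset.prod_eq_zero (Finset.mem_univ ⟨n, by omega⟩)
        (by rw [← h, zero_pow (hmn j hj).ne'])
    have hsmall : ∀ j : Fin l, y j ≠ 0 → j.val < n := fun j hj => by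
      rcases lt_trichotomy j.val n with h' | h' | h'
      · exact h'
      · have hi : j = ⟨n, by omega⟩ := Fin.ext h'
        exact absurd (hi ▸ h.symm) hj
      · exact absurd (hlarge j h') hj
    obtain ⟨j, -, hj⟩ : ∃ j ∈ Finset.univ, y j ≠ 0 := by
      refine Finset.exists_ne_zero_of_sum_ne_zero ?_
      rw [hy.2]; exact one_ne_zero
    refine Finset.sum_pos' (fun i _ => ?_)
      ⟨j, Finset.mem_univ _, mul_pos (hc j (hsmall j hj)) ((hy.1 j).lt_of_ne hj.symm)⟩
    by_cases hi : y i = 0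
    · simp [hi]
    · exact mul_nonneg (hc i (hsmall i hi)).le (hy.1 i)

/-! ### SAGE membership from nonnegative coefficients -/

theorem isAMGMExponential_single {n : ℕ} {M : Set (Fin n → ℝ)} {a : Fin n → ℝ} (ha : a ∈ M)
    {b : ℝ} (hb : 0 ≤ b) : IsAMGMExponential M (fun x => b * Real.exp (a ⬝ᵥ x)) := by
  classical
  refine ⟨Finsupp.single a b, ?_, ?_, fun x => ?_, fun x => by positivity⟩
  · intro v hv
    have := Finsupp.support_single_subset (Finset.mem_coe.1 hv)
    rw [Finset.mem_singleton] at this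
    exact this ▸ ha
  · intro v hv
    have hv : Finsupp.single a b v < 0 := hv
    rw [Finsupp.single_apply] at hv
    split_ifs at hv <;> linarith
  · have : (Finsupp.single a b).sum (fun v r => r * Real.exp (v ⬝ᵥ x)) =
        b * Real.exp (a ⬝ᵥ x) := Finsupp.sum_single_index (by simp)
    exact this.symm

theorem sum_mem_SAGE {n : ℕ} {M : Set (Fin n → ℝ)} {κ : Type*} (s : Finset κ)
    (F : κ → (Fin n → ℝ) → ℝ) (hF : ∀ i ∈ s, IsAMGMExponential M (F i))
    {g : (Fin n → ℝ) → ℝ} (hg : ∀ x, g x = ∑ i ∈ s, F i x) : g ∈ SAGE M := by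
  refine ⟨s.card, fun i => F (s.equivFin.symm i), fun i => hF _ (s.equivFin.symm i).2,
    fun x => ?_⟩
  rw [hg, ← Finset.sum_coe_sort s, ← Equiv.sum_comp s.equivFin.symm]

/-- Each monomial alone is an AM/GM-exponential, so monomials with equal exponents need not be
collected. -/
theorem eval_exp_mem_SAGE {n : ℕ} {ι : Type*} [Fintype ι] (α : ι → Fin n → ℝ) {D : ℕ}
    (F : MvPolynomial ι ℝ) (hF : F.IsHomogeneous D) (hcoeff : ∀ γ, 0 ≤ F.coeff γ) :
    (fun x => MvPolynomial.eval (fun j => Real.exp (α j ⬝ᵥ x)) F) ∈ SAGE (exponentSums D α) := by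
  refine sum_mem_SAGE F.support
    (fun γ x => F.coeff γ * Real.exp ((∑ j, γ j • α j) ⬝ᵥ x)) (fun γ hγ => isAMGMExponential_single ?_ (hcoeff γ)) fun x => ?_
  · refine ⟨γ, ?_, rfl⟩
    rw [← Finsupp.degree_eq_sum, Finsupp.degree_eq_weight_one]
    exact (hF (MvPolynomial.mem_support_iff.1 hγ)).le
  · rw [MvPolynomial.eval_eq']
    refine Finset.sum_congr rfl fun γ _ => ?_
    simp_rw [← Real.exp_nat_mul]
    rw [← Real.exp_sum, sum_dotProduct]
    simp_rw [smul_dotProduct, nsmul_eq_mul]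

theorem nonneg_of_mem_SAGE {n : ℕ} {M : Set (Fin n → ℝ)} {f : (Fin n → ℝ) → ℝ}
    (hf : f ∈ SAGE M) (x : Fin n → ℝ) : 0 ≤ f x := by
  obtain ⟨k, F, hF, h⟩ := hf
  rw [h]
  refine Finset.sum_nonneg fun i _ => ?_
  obtain ⟨_, -, -, -, h0⟩ := hF i
  exact h0 x

/-! ### Certificates and completeness -/

/-- A signomial with positive infimum becomes a SAGE function after multiplication by any
sufficiently high power of `∑ j, exp ⟨α j, x⟩`. -/
theorem eventually_multiplied_mem_SAGE {n l : ℕ} (hl : n < l) (α : Fin l → Fin n → ℝ)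
    (c : Fin l → ℝ) (hrat : ∀ j k, ∃ q : ℚ, α j k = (q : ℝ))
    (hind : LinearIndependent ℝ (fun i : Fin n => α ⟨i.val, by omega⟩))
    (hzero : α ⟨n, by omega⟩ = 0)
    (hconv : ∀ j : Fin l, n < j.val →
      α j ∈ convexHull ℝ (α '' {i : Fin l | i.val ≤ n}) ∧
      α j ∉ convexHull ℝ (α '' {i : Fin l | i.val < n}))
    (hc : ∀ j : Fin l, j.val < n → 0 < c j)
    {ε : ℝ} (hε0 : 0 < ε) (hε : ∀ x, ε ≤ signomial α c x) :
    ∀ᶠ p : ℕ in atTop, multiplied α p (signomial α c) ∈ SAGE (exponentSums (p + 1) α) := by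
  obtain ⟨q, hq, m, hm⟩ := exists_barycentric_relations hl α hrat hind hzero hconv
  let P : MvPolynomial (Fin l) ℝ := ∑ i, MvPolynomial.X i
  let h : Fin l → MvPolynomial (Fin l) ℝ := fun j =>
    MvPolynomial.X j ^ q - ∏ i, MvPolynomial.X i ^ m j i
  -- The factor `P ^ (2 * q - 1)` raises the linear form to the degree of `H`, and becomes part of
  -- the multiplier.
  let G : MvPolynomial (Fin l) ℝ :=
    (∑ j, MvPolynomial.C (c j) * MvPolynomial.X j) * P ^ (2 * q - 1)
  let H : MvPolynomial (Fin l) ℝ := ∑ j, h j ^ 2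
  have hevalP : ∀ y, MvPolynomial.eval y P = ∑ i, y i := fun y => by simp [P]
  have hevalG : ∀ y, MvPolynomial.eval y G =
      (∑ j, c j * y j) * (∑ i, y i) ^ (2 * q - 1) := fun y => by simp [G, P]
  have hevalH : ∀ y, MvPolynomial.eval y H = ∑ j, (y j ^ q - ∏ i, y i ^ m j i) ^ 2 :=
    fun y => by simp [H, h]
  have hP : P.IsHomogeneous 1 :=
    MvPolynomial.IsHomogeneous.sum _ _ _ fun i _ => MvPolynomial.isHomogeneous_X _ i
  have hG : G.IsHomogeneous (2 * q) := by
    have h1 : (∑ j, MvPolynomial.C (c j) * MvPolynomial.X j :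
        MvPolynomial (Fin l) ℝ).IsHomogeneous 1 :=
      MvPolynomial.IsHomogeneous.sum _ _ _ fun i _ => MvPolynomial.isHomogeneous_C_mul_X _ i
    have := h1.mul (hP.pow (2 * q - 1))
    rwa [show 1 + 1 * (2 * q - 1) = 2 * q by omega] at this
  have hh : ∀ j, (h j).IsHomogeneous q := fun j => by
    refine (MvPolynomial.isHomogeneous_X_pow j q).sub ?_
    have := MvPolynomial.IsHomogeneous.prod Finset.univ
      (fun i : Fin l => (MvPolynomial.X i ^ m j i : MvPolynomial (Fin l) ℝ)) (m j)
      fun i _ => MvPolynomial.isHomogeneous_X_pow i _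
    rwa [(hm j).1] at this
  have hH : H.IsHomogeneous (2 * q) :=
    MvPolynomial.IsHomogeneous.sum _ _ _ fun j _ => by
      have := (hh j).pow 2
      rwa [mul_comm] at this
  obtain ⟨C, hC⟩ := exists_pos_add_mul_of_pos_on_zeros (isCompact_stdSimplex ℝ (Fin l))
    (MvPolynomial.continuous_eval G) (MvPolynomial.continuous_eval H)
    (fun y _ => by rw [hevalH]; exact Finset.sum_nonneg fun j _ => sq_nonneg _)
    (fun y hy hHy => by
      rw [hevalG, hy.2, one_pow, mul_one]
      refine sum_pos_of_relations hl α c hind hzero hc hq m (fun j => (hm j).1)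
        (fun j => (hm j).2.1) (fun j => (hm j).2.2.1) (fun j => (hm j).2.2.2) hε0 hε y hy
        fun j => ?_
      rw [hevalH, Finset.sum_eq_zero_iff_of_nonneg fun j _ => sq_nonneg _] at hHy
      exact sub_eq_zero.1 (pow_eq_zero_iff two_ne_zero |>.1 (hHy j (Finset.mem_univ j))))
  have hF : (G + MvPolynomial.C C * H).IsHomogeneous (2 * q) := hG.add (hH.C_mul C)
  have hpolya := polya (G + MvPolynomial.C C * H) (2 * q) hF fun y hy => by simpa using hC y hy
  obtain ⟨N₀, hN₀⟩ := eventually_atTop.1 hpolya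
  filter_upwards [eventually_ge_atTop (N₀ + (2 * q - 1))] with p hp
  obtain ⟨N, rfl⟩ : ∃ N, p = N + (2 * q - 1) := ⟨p - (2 * q - 1), by omega⟩
  have hhom : (P ^ N * (G + MvPolynomial.C C * H)).IsHomogeneous (N + (2 * q - 1) + 1) := by
    have := (hP.pow N).mul hF
    rwa [show 1 * N + 2 * q = N + (2 * q - 1) + 1 by omega] at this
  have hmem := eval_exp_mem_SAGE α _ hhom (hN₀ N (by omega))
  convert hmem using 1
  ext x
  have hzeroH : MvPolynomial.eval (fun j => Real.exp (α j ⬝ᵥ x)) H = 0 := by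
    rw [hevalH]
    refine Finset.sum_eq_zero fun j _ => ?_
    rw [exp_dotProduct_pow_eq (hm j).2.2.1 x, sub_self, zero_pow two_ne_zero]
  rw [map_mul, map_add, map_mul _ (MvPolynomial.C C) H, hzeroH, map_pow, hevalP, hevalG, multiplied, signomial, pow_add]
  ring

theorem theorem1 (n l : ℕ) (hl : n + 1 ≤ l) (α : Fin l → Fin n → ℝ) (c : Fin l → ℝ)
    (hrat : ∀ j k, ∃ q : ℚ, α j k = (q : ℝ))
    (hind : LinearIndependent ℝ (fun i : Fin n => α ⟨i.val, by omega⟩))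
    (hzero : α ⟨n, by omega⟩ = 0)
    (hconv : ∀ j : Fin l, n < j.val →
      α j ∈ convexHull ℝ (α '' {i : Fin l | i.val ≤ n}) ∧
      α j ∉ convexHull ℝ (α '' {i : Fin l | i.val < n}))
    (hc : ∀ j : Fin l, j.val < n → 0 < c j) :
    (0 < globalInf (signomial α c) →
      ∃ p : ℕ, multiplied α p (signomial α c) ∈ SAGE (exponentSums (p + 1) α)) ∧
    (∀ p : ℕ, sageBound α p (signomial α c) ≤ globalInf (signomial α c)) ∧
    Tendsto (fun p : ℕ => sageBound α p (signomial α c)) atTop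
      (𝓝 (globalInf (signomial α c))) := by
  have hle : ∀ p : ℕ, sageBound α p (signomial α c) ≤ globalInf (signomial α c) := by
    intro p
    refine sSup_le ?_
    rintro _ ⟨γ, hγ, rfl⟩
    refine le_iInf fun x => ?_
    have h0 := nonneg_of_mem_SAGE hγ x
    have hpos : 0 < ∑ j, Real.exp (α j ⬝ᵥ x) :=
      Finset.sum_pos (fun j _ => Real.exp_pos _) ⟨⟨n, by omega⟩, Finset.mem_univ _⟩
    have := nonneg_of_mul_nonneg_right h0 (pow_pos hpos p)
    exact EReal.coe_le_coe_iff.2 (sub_nonneg.1 this)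
  refine ⟨fun hinf => ?_, hle, ?_⟩
  · obtain ⟨ε, hε0, hε⟩ := EReal.lt_iff_exists_real_btwn.1 hinf
    exact (eventually_multiplied_mem_SAGE hl α c hrat hind hzero hconv hc
      (EReal.coe_pos.1 hε0)
      fun x => EReal.coe_le_coe_iff.1 (hε.le.trans (iInf_le _ x))).exists
  · refine tendsto_order.2 ⟨fun a ha => ?_, fun a ha => Eventually.of_forall fun p =>
      (hle p).trans_lt ha⟩
    -- Two reals are inserted: `γ` is the feasible bound, and `δ - γ > 0` is the margin below `f -
    -- γ`.
    obtain ⟨γ, haγ, hγ⟩ := EReal.lt_iff_exists_real_btwn.1 ha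
    obtain ⟨δ, hγδ, hδ⟩ := EReal.lt_iff_exists_real_btwn.1 hγ
    -- Subtracting `γ` changes only the constant term, whose sign is unconstrained.
    let c' : Fin l → ℝ := fun j => c j - if j.val = n then γ else 0
    have hc' : ∀ x, signomial α c' x = signomial α c x - γ := by
      intro x
      have hsum : ∑ j : Fin l, (if j.val = n then γ else 0) * Real.exp (α j ⬝ᵥ x) = γ := by
        rw [Finset.sum_eq_single (⟨n, by omega⟩ : Fin l)]
        · simp [hzero]
        · intro j _ hj
          rw [if_neg fun h => hj (Fin.ext h), zero_mul]
        · simp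
      simp only [signomial, c', sub_mul, Finset.sum_sub_distrib, hsum]
    have hev := eventually_multiplied_mem_SAGE hl α c' hrat hind hzero hconv
      (fun j hj => by simpa [c', hj.ne] using hc j hj)
      (sub_pos.2 (EReal.coe_lt_coe_iff.1 hγδ)) fun x => by
        rw [hc']
        exact sub_le_sub_right (EReal.coe_le_coe_iff.1 (hδ.le.trans (iInf_le _ x))) γ
    filter_upwards [hev] with p hp
    refine haγ.trans_le (le_sSup ⟨γ, ?_, rfl⟩)
    rwa [funext hc'] at hp
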